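/- For an odd positive integer $k$ and a nonnegative integer $n$ let $$E(k,n)=\sum_{0\le i\le (n-1)/2}\binom{n}{i}\left(\cos^2\frac{\pi k}{2(2k+1)}\right)^{i}\left(\sin^2\frac{\pi k}{2(2k+1)}\right)^{n-i},$$ the sum being over the integers $i$ with $0\le i\le (n-1)/2$; this is the probability that a binomial random variable with parameters $n$ and $\cos^2\frac{\pi k}{2(2k+1)}$ is at most $(n-1)/2$. Let $\Phi$ be the distribution function of the standard normal law. Then, as $k\to\infty$ through the odd positive integers: 1. $E(k,k)\to \frac12$; 2. $E(k,k^2)\to \Phi(-\pi/4)$, and $\Phi(-\pi/4)>0.2$; 3. $E(k,k^s)\to 0$ for every integer $s>2$; more generally, for every real $s>2$ and every sequence of nonnegative integers $g(k)$ with $|g(k)-k^s|\le 1$ for all odd $k$ (for example $k^s$ rounded down, rounded up, or rounded to a nearest odd integer), $E(k,g(k))\to 0$. -/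

import Mathlib

open Filter Topology

/-- `majorityError k n` is `E(k, n)`: the sum over the integers `0 ≤ i ≤ (n - 1) / 2`
(an inequality between real numbers) of
`(n choose i) (cos² (π k / (2 (2 k + 1)))) ^ i (sin² (π k / (2 (2 k + 1)))) ^ (n - i)`. -/
noncomputable def majorityError (k n : ℕ) : ℝ :=
  ∑ i ∈ (Finset.range (n + 1)).filter (fun i : ℕ => (i : ℝ) ≤ ((n : ℝ) - 1) / 2),
    (n.choose i : ℝ)
      * (Real.cos (Real.pi * (k : ℝ) / (2 * (2 * (k : ℝ) + 1))) ^ 2) ^ i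
      * (Real.sin (Real.pi * (k : ℝ) / (2 * (2 * (k : ℝ) + 1))) ^ 2) ^ (n - i)

/-- The filter of odd natural numbers tending to infinity. -/
def oddAtTop : Filter ℕ := atTop ⊓ 𝓟 {k : ℕ | Odd k}

/-- The distribution function `Φ` of the standard normal law. -/
noncomputable def stdNormalCDF (x : ℝ) : ℝ :=
  ProbabilityTheory.cdf (ProbabilityTheory.gaussianReal 0 1) x

/-! Let `X` be binomial with parameters `n` and `p = cos² (π k / (2 (2 k + 1)))`. Then `E(k, n)` is
the probability that `2 X < n`, and `2 p - 1 = sin ((π / 4) / (k + 1 / 2))` is asymptotic to `π / (4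
k)`. If `√n (2 p - 1) → c`, then `(2 X - n) / √n` converges in law to `N(c, 1)`, by characteristic
functions since `p` varies with `n`; hence `E → Φ(-c)`, with `c = 0` for `n = k` and `c = π / 4` for
`n = k ^ 2`. For `s > 2` the mean drifts to infinity, and Chebyshev gives `E ≤ 1 / (n (2 p - 1) ^ 2)
→ 0`. -/

open MeasureTheory ProbabilityTheory
open scoped unitInterval

/-- The general `(1 + t / n + o(1 / n)) ^ n → exp t` along an arbitrary filter. -/
lemma tendsto_one_add_pow_cexp {ι : Type*} {l : Filter ι} {n : ι → ℕ} {g : ι → ℂ} {t : ℂ}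
    (hn : Tendsto n l atTop) (hg : Tendsto (fun i => (n i : ℂ) * g i) l (𝓝 t)) :
    Tendsto (fun i => (1 + g i) ^ n i) l (𝓝 (Complex.exp t)) := by
  have hn0 : ∀ᶠ i in l, (n i : ℂ) ≠ 0 := by
    filter_upwards [hn.eventually_ge_atTop 1] with i hi
    exact_mod_cast (by omega : n i ≠ 0)
  have hinv : Tendsto (fun i => (n i : ℂ)⁻¹) l (𝓝 0) :=
    (tendsto_inv_atTop_nhds_zero_nat (𝕜 := ℂ)).comp hn
  have hg0 : Tendsto g l (𝓝 0) := by
    have := hinv.mul hg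
    rw [zero_mul] at this
    refine this.congr' ?_
    filter_upwards [hn0] with i hi
    field_simp
  have hder : HasDerivAt (fun z : ℂ => Complex.log (1 + z)) 1 0 := by
    have := ((hasDerivAt_id (0 : ℂ)).const_add 1).clog (by simp)
    simpa using this
  -- `dslope` writes `log (1 + z)` as `z` times a function continuous at `0`, so no case split on `g
  -- i = 0` is needed.
  have hcont : Tendsto (dslope (fun z : ℂ => Complex.log (1 + z)) 0) (𝓝 0) (𝓝 1) := by
    have := (continuousAt_dslope_same.2 hder.differentiableAt).tendsto
    rwa [dslope_same, hder.deriv] at this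
  have hlog : Tendsto (fun i => (n i : ℂ) * Complex.log (1 + g i)) l (𝓝 t) := by
    have := hg.mul (hcont.comp hg0)
    rw [mul_one] at this
    refine this.congr fun i => ?_
    have h := sub_smul_dslope (fun z : ℂ => Complex.log (1 + z)) 0 (g i)
    simp only [sub_zero, add_zero, Complex.log_one, smul_eq_mul] at h
    rw [← h, Function.comp_apply, mul_assoc]
  refine ((Complex.continuous_exp.tendsto t).comp hlog).congr' ?_
  filter_upwards [hg0.eventually_ne (show (0 : ℂ) ≠ -1 by simp)] with i hi
  have h1 : 1 + g i ≠ 0 := fun h => hi (eq_neg_of_add_eq_zero_right h)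
  rw [Function.comp_apply, Complex.exp_nat_mul, Complex.exp_log h1]

/-- If `x → ∞` then `x sin (a / x) → a`. -/
lemma tendsto_mul_sin_div {ι : Type*} {l : Filter ι} {x : ι → ℝ} (hx : Tendsto x l atTop)
    (a : ℝ) : Tendsto (fun i => x i * Real.sin (a / x i)) l (𝓝 a) := by
  have h0 : Tendsto (fun i => a / x i) l (𝓝 0) := hx.const_div_atTop a
  have h1 := ((Real.continuous_sinc.tendsto 0).comp h0).const_mul a
  rw [Real.sinc_zero, mul_one] at h1
  refine h1.congr' ?_
  filter_upwards [hx.eventually_gt_atTop 0] with i hi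
  rcases eq_or_ne a 0 with rfl | ha
  · simp
  · rw [Function.comp_apply, Real.sinc_of_ne_zero (by positivity)]
    field_simp

/-- The law of `(2 X - n) / √n`, where `X` is binomial with parameters `n` and `p`. -/
noncomputable def scaledBinomial (n : ℕ) (p : I) : Measure ℝ :=
  (binomial n p).map (fun i : ℕ => (2 * (i : ℝ) - n) / √n)

instance (n : ℕ) (p : I) : IsProbabilityMeasure (scaledBinomial n p) :=
  Measure.isProbabilityMeasure_map (by fun_prop)

/-- `2 X - n` is a sum of `n` independent signs, `+1` with probability `p`; the base of the power is
the characteristic function of one sign at `t / √n`. -/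
lemma charFun_scaledBinomial (n : ℕ) (p : I) (t : ℝ) :
    charFun (scaledBinomial n p) t =
      (Real.cos (t / √n) + (2 * (p : ℝ) - 1 : ℝ) * Real.sin (t / √n) * Complex.I) ^ n := by
  have hbase : (Real.cos (t / √n) + (2 * (p : ℝ) - 1 : ℝ) * Real.sin (t / √n) * Complex.I : ℂ) =
      (p : ℝ) * Complex.exp ((t / √n : ℝ) * Complex.I)
        + (1 - (p : ℝ)) * Complex.exp (-((t / √n : ℝ) * Complex.I)) := by
    rw [← neg_mul, Complex.exp_mul_I, Complex.exp_mul_I, Complex.cos_neg, Complex.sin_neg]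
    push_cast
    ring
  rw [hbase, add_pow, charFun_apply_real, scaledBinomial,
    integral_map (by fun_prop) (by fun_prop), integral_binomial, Nat.range_succ_eq_Iic]
  refine Finset.sum_congr rfl fun i hi => ?_
  have hin : i ≤ n := Finset.mem_Iic.1 hi
  have hexp : Complex.exp (t * ((2 * (i : ℝ) - n) / √n : ℝ) * Complex.I) =
      Complex.exp ((t / √n : ℝ) * Complex.I) ^ i
        * Complex.exp (-((t / √n : ℝ) * Complex.I)) ^ (n - i) := by
    rw [← Complex.exp_nat_mul, ← Complex.exp_nat_mul, ← Complex.exp_add]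
    congr 1
    push_cast [Nat.cast_sub hin]
    ring
  rw [hexp, Complex.real_smul, mul_pow, mul_pow]
  push_cast
  ring

/-- Convergence of characteristic functions in the central limit theorem for the
scaled binomial law. -/
lemma tendsto_charFun_scaledBinomial {ι : Type*} {l : Filter ι} {n : ι → ℕ} {p : ι → I} {c : ℝ}
    (hn : Tendsto n l atTop)
    (hc : Tendsto (fun i => √(n i) * (2 * (p i : ℝ) - 1)) l (𝓝 c)) (t : ℝ) :
    Tendsto (fun i => charFun (scaledBinomial (n i) (p i)) t) l
      (𝓝 (charFun (gaussianReal c 1) t)) := by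
  have hs : Tendsto (fun i => √(n i : ℝ)) l atTop :=
    Real.tendsto_sqrt_atTop.comp (tendsto_natCast_atTop_atTop.comp hn)
  have hre : Tendsto (fun i => (n i : ℝ) * (Real.cos (t / √(n i)) - 1)) l (𝓝 (-(t ^ 2 / 2))) := by
    -- Uses `cos u - 1 = -2 sin² (u / 2)`.
    have h := ((tendsto_mul_sin_div hs (t / 2)).pow 2).const_mul (-2)
    rw [show -2 * (t / 2) ^ 2 = -(t ^ 2 / 2) by ring] at h
    refine h.congr fun i => ?_
    rw [mul_pow, Real.sq_sqrt (Nat.cast_nonneg _), Real.sin_sq_eq_half_sub,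
      show 2 * (t / 2 / √(n i : ℝ)) = t / √(n i) by ring]
    ring
  have him : Tendsto (fun i => (n i : ℝ) * ((2 * (p i : ℝ) - 1) * Real.sin (t / √(n i)))) l
      (𝓝 (c * t)) := by
    refine (hc.mul (tendsto_mul_sin_div hs t)).congr fun i => ?_
    rw [mul_mul_mul_comm, mul_comm (√(n i : ℝ)), mul_assoc, ← mul_assoc (√(n i : ℝ)),
      Real.mul_self_sqrt (Nat.cast_nonneg _)]
  have hg : Tendsto (fun i => (n i : ℂ) * ((Real.cos (t / √(n i)) - 1 : ℝ)
      + ((2 * (p i : ℝ) - 1) * Real.sin (t / √(n i)) : ℝ) * Complex.I)) l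
      (𝓝 ((-(t ^ 2 / 2) : ℝ) + (c * t : ℝ) * Complex.I)) := by
    refine (hre.ofReal.add (him.ofReal.mul_const Complex.I)).congr fun i => ?_
    push_cast
    ring
  have h := tendsto_one_add_pow_cexp hn hg
  rw [charFun_gaussianReal]
  convert h using 2
  · rw [charFun_scaledBinomial]
    congr 1
    push_cast
    ring
  · push_cast
    ring_nf

/-- The central limit theorem for the scaled binomial law, on the negative half-line. -/
lemma tendsto_scaledBinomial_real_Iio {n : ℕ → ℕ} {p : ℕ → I} {c : ℝ}
    (hn : Tendsto n atTop atTop)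
    (hc : Tendsto (fun i => √(n i) * (2 * (p i : ℝ) - 1)) atTop (𝓝 c)) :
    Tendsto (fun i => (scaledBinomial (n i) (p i)).real (Set.Iio 0)) atTop
      (𝓝 (stdNormalCDF (-c))) := by
  have hw : Tendsto (β := ProbabilityMeasure ℝ)
      (fun i => ⟨scaledBinomial (n i) (p i), inferInstance⟩) atTop
      (𝓝 (⟨gaussianReal c 1, inferInstance⟩ : ProbabilityMeasure ℝ)) :=
    ProbabilityMeasure.tendsto_of_tendsto_charFun (tendsto_charFun_scaledBinomial hn hc)
  have := nullSingletonClass_gaussianReal (μ := c) (v := 1) one_ne_zero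
  have hfr : gaussianReal c 1 (frontier (Set.Iio 0)) = 0 := by simp
  have h := ProbabilityMeasure.tendsto_measure_of_null_frontier_of_tendsto' hw hfr
  have hlim : stdNormalCDF (-c) = (gaussianReal c 1).real (Set.Iio 0) := by
    have hmap := gaussianReal_map_add_const (μ := 0) (v := 1) c
    rw [zero_add] at hmap
    rw [stdNormalCDF, cdf_eq_real, measureReal_congr Iio_ae_eq_Iic, ← hmap,
      map_measureReal_apply (by fun_prop) measurableSet_Iic]
    congr 1
    ext x
    simp
  rw [hlim]
  exact (ENNReal.tendsto_toReal (measure_ne_top _ _)).comp h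

/-- The success probability `cos² (π k / (2 (2 k + 1)))`. -/
noncomputable def cosSqProb (k : ℕ) : I :=
  ⟨Real.cos (Real.pi * (k : ℝ) / (2 * (2 * (k : ℝ) + 1))) ^ 2, sq_nonneg _, Real.cos_sq_le_one _⟩

lemma one_sub_cosSqProb (k : ℕ) : 1 - (cosSqProb k : ℝ) =
    Real.sin (Real.pi * (k : ℝ) / (2 * (2 * (k : ℝ) + 1))) ^ 2 := by
  rw [Real.sin_sq, cosSqProb]

lemma two_mul_cosSqProb_sub_one (k : ℕ) : 2 * (cosSqProb k : ℝ) - 1 =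
    Real.sin (Real.pi / 4 / ((k : ℝ) + 1 / 2)) := by
  rw [cosSqProb, ← Real.cos_two_mul, ← Real.cos_pi_div_two_sub]
  congr 1
  field_simp
  ring

lemma majorityError_eq_sum (k n : ℕ) : majorityError k n =
    ∑ i ∈ (Finset.range (n + 1)).filter (fun i : ℕ => (i : ℝ) ≤ ((n : ℝ) - 1) / 2),
      (n.choose i : ℝ) * (cosSqProb k : ℝ) ^ i * (1 - (cosSqProb k : ℝ)) ^ (n - i) := by
  rw [one_sub_cosSqProb]
  rfl

lemma majorityError_eq_scaledBinomial (k n : ℕ) :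
    majorityError k n = (scaledBinomial n (cosSqProb k)).real (Set.Iio 0) := by
  rw [majorityError_eq_sum, scaledBinomial, map_measureReal_apply (by fun_prop) measurableSet_Iio,
    ← integral_indicator_one .of_discrete, integral_binomial, Finset.sum_filter,
    Nat.range_succ_eq_Iic]
  refine Finset.sum_congr rfl fun i hi => ?_
  have hin : i ≤ n := Finset.mem_Iic.1 hi
  have hiff : (i : ℝ) ≤ ((n : ℝ) - 1) / 2 ↔ (2 * (i : ℝ) - n) / √n < 0 := by
    -- For `n = 0` division by `√0 = 0` gives `0`, so both sides are false.
    rcases Nat.eq_zero_or_pos n with rfl | hn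
    · have : (0 : ℝ) ≤ i := i.cast_nonneg
      simp only [Nat.cast_zero, Real.sqrt_zero, div_zero, lt_irrefl, iff_false, not_le]
      linarith
    · have hs : 0 < √(n : ℝ) := Real.sqrt_pos.2 (by exact_mod_cast hn)
      rw [div_lt_iff₀ hs, zero_mul, le_div_iff₀ two_pos, sub_neg, le_sub_iff_add_le]
      norm_cast
      omega
  by_cases h : (i : ℝ) ≤ ((n : ℝ) - 1) / 2
  · simp [h, hiff.1 h]
  · simp [h, mt hiff.2 h]

lemma tendsto_majorityError {n : ℕ → ℕ} {c : ℝ} (hn : Tendsto n atTop atTop)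
    (hc : Tendsto (fun k => √(n k) * (2 * (cosSqProb k : ℝ) - 1)) atTop (𝓝 c)) :
    Tendsto (fun k => majorityError k (n k)) atTop (𝓝 (stdNormalCDF (-c))) := by
  simp_rw [majorityError_eq_scaledBinomial]
  exact tendsto_scaledBinomial_real_Iio hn hc

lemma tendsto_mul_two_mul_cosSqProb_sub_one :
    Tendsto (fun k : ℕ => (k : ℝ) * (2 * (cosSqProb k : ℝ) - 1)) atTop (𝓝 (Real.pi / 4)) := by
  have hx : Tendsto (fun k : ℕ => (k : ℝ) + 1 / 2) atTop atTop :=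
    tendsto_atTop_add_const_right _ _ tendsto_natCast_atTop_atTop
  -- Write `k = (k + 1 / 2) - 1 / 2`.
  have h := (tendsto_mul_sin_div hx (Real.pi / 4)).sub
    (((Real.continuous_sin.tendsto 0).comp (hx.const_div_atTop (Real.pi / 4))).mul_const (1 / 2))
  simp only [Real.sin_zero, zero_mul, sub_zero] at h
  refine h.congr fun k => ?_
  rw [two_mul_cosSqProb_sub_one, Function.comp_apply]
  ring

lemma majorityError_nonneg (k n : ℕ) : 0 ≤ majorityError k n := by
  rw [majorityError_eq_scaledBinomial]
  exact measureReal_nonneg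

lemma sum_binomial_mul_sq (n : ℕ) (p : ℝ) :
    ∑ i ∈ Finset.range (n + 1), (n.choose i : ℝ) * p ^ i * (1 - p) ^ (n - i) * (n * p - i) ^ 2 =
      n * p * (1 - p) := by
  have h := congrArg (Polynomial.eval p) (bernsteinPolynomial.variance ℝ n)
  simp only [Polynomial.eval_finsetSum, bernsteinPolynomial, Polynomial.eval_mul,
    Polynomial.eval_pow, Polynomial.eval_sub, nsmul_eq_mul, Polynomial.eval_X,
    Polynomial.eval_one, Polynomial.eval_natCast] at h
  rw [← h]
  exact Finset.sum_congr rfl fun i _ => by ring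

/-- Chebyshev's inequality for the binomial law. -/
lemma majorityError_mul_le_one (k n : ℕ) :
    majorityError k n * (n * (2 * (cosSqProb k : ℝ) - 1) ^ 2) ≤ 1 := by
  rcases Nat.eq_zero_or_pos n with rfl | hn
  · simp
  have hn' : (0 : ℝ) < n := by exact_mod_cast hn
  have hm : 0 ≤ 2 * (cosSqProb k : ℝ) - 1 := by
    rw [two_mul_cosSqProb_sub_one]
    have hk : (0 : ℝ) ≤ k := k.cast_nonneg
    refine Real.sin_nonneg_of_nonneg_of_le_pi (by positivity) ?_
    rw [div_le_iff₀ (by positivity)]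
    nlinarith [Real.pi_pos, mul_nonneg Real.pi_pos.le hk]
  set p : ℝ := (cosSqProb k : ℝ) with hp
  have hp0 : 0 ≤ p := (cosSqProb k).2.1
  have hp1 : 0 ≤ 1 - p := sub_nonneg.2 (cosSqProb k).2.2
  -- Every summed `i` satisfies `n p - i ≥ n (2 p - 1) / 2 ≥ 0`.
  have key : majorityError k n * (n * (2 * p - 1) / 2) ^ 2 ≤ n * p * (1 - p) := by
    rw [← sum_binomial_mul_sq, majorityError_eq_sum, Finset.sum_mul]
    refine (Finset.sum_le_sum fun i hi => ?_).trans
      (Finset.sum_le_sum_of_subset_of_nonneg (Finset.filter_subset _ _) fun i _ _ => by positivity)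
    have hi' := (Finset.mem_filter.1 hi).2
    have h0 : 0 ≤ n * (2 * p - 1) / 2 := by positivity
    refine mul_le_mul_of_nonneg_left (pow_le_pow_left₀ h0 ?_ 2) (by positivity)
    linarith
  have hpp : p * (1 - p) ≤ 1 / 4 := by nlinarith [sq_nonneg (2 * p - 1)]
  have h4 : n * (majorityError k n * (n * (2 * p - 1) ^ 2)) ≤ n * 1 := by
    nlinarith [mul_le_mul_of_nonneg_left hpp hn'.le]
  exact le_of_mul_le_mul_left h4 hn'

lemma tendsto_majorityError_zero {l : Filter ℕ} {n : ℕ → ℕ}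
    (h : Tendsto (fun k => (n k : ℝ) * (2 * (cosSqProb k : ℝ) - 1) ^ 2) l atTop) :
    Tendsto (fun k => majorityError k (n k)) l (𝓝 0) := by
  refine squeeze_zero' (.of_forall fun k => majorityError_nonneg k (n k)) ?_
    (tendsto_inv_atTop_zero.comp h)
  filter_upwards [h.eventually_gt_atTop 0] with k hk
  rw [Function.comp_apply, ← one_div, le_div_iff₀ hk]
  exact majorityError_mul_le_one k (n k)

lemma tendsto_majorityError_rpow {s : ℝ} (hs : 2 < s) {g : ℕ → ℕ}
    (hg : ∀ k : ℕ, Odd k → |(g k : ℝ) - (k : ℝ) ^ s| ≤ 1) :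
    Tendsto (fun k : ℕ => majorityError k (g k)) oddAtTop (𝓝 (0 : ℝ)) := by
  apply tendsto_majorityError_zero
  have hle : oddAtTop ≤ atTop := inf_le_left
  have hsq := tendsto_mul_two_mul_cosSqProb_sub_one.pow 2
  have hpow : Tendsto (fun k : ℕ => (k : ℝ) ^ (s - 2) - 1) atTop atTop :=
    tendsto_atTop_add_const_right _ _
      ((tendsto_rpow_atTop (by linarith)).comp tendsto_natCast_atTop_atTop)
  have hlim := (hpow.atTop_mul_pos (by positivity) hsq).mono_left hle
  refine tendsto_atTop_mono' _ ?_ hlim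
  have hodd : ∀ᶠ k in oddAtTop, Odd k := mem_inf_of_right (mem_principal_self _)
  filter_upwards [hodd] with k hk
  have hk1 : (1 : ℝ) ≤ k := by exact_mod_cast hk.pos
  have hk0 : (0 : ℝ) < k := by linarith
  have h1 := (abs_le.1 (hg k hk)).1
  have h2 : (k : ℝ) ^ s = (k : ℝ) ^ (s - 2) * (k : ℝ) ^ 2 := by
    rw [← Real.rpow_natCast (k : ℝ) 2, ← Real.rpow_add hk0]
    norm_num
  rw [mul_pow, ← mul_assoc]
  refine mul_le_mul_of_nonneg_right ?_ (sq_nonneg _)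
  -- As `k ^ 2 ≥ 1`, `g k ≥ k ^ s - 1 ≥ (k ^ (s - 2) - 1) k ^ 2`.
  nlinarith

lemma stdNormalCDF_zero : stdNormalCDF 0 = 1 / 2 := by
  have := nullSingletonClass_gaussianReal (μ := 0) (v := 1) one_ne_zero
  rw [stdNormalCDF, cdf_eq_real]
  have hsymm : (gaussianReal 0 1).real (Set.Iic 0) = (gaussianReal 0 1).real (Set.Ioi 0) := by
    have hmap := gaussianReal_map_neg (μ := 0) (v := 1)
    rw [neg_zero] at hmap
    conv_lhs => rw [← hmap, map_measureReal_apply (by fun_prop) measurableSet_Iic]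
    rw [measureReal_congr Ioi_ae_eq_Ici]
    congr 1
    ext x
    simp
  have hadd := probReal_add_probReal_compl (μ := gaussianReal 0 1) (measurableSet_Iic (a := (0 : ℝ)))
  rw [Set.compl_Iic, ← hsymm] at hadd
  linarith

/-- With `y = x ^ 2 / 2`, `exp (-y) ≤ 1 / (1 + y) ≤ 1 - y + y ^ 2`, because `(1 + y) (1 - y + y ^ 2)
= 1 + y ^ 3`. The polynomial bound can be integrated exactly. -/
lemma gaussianPDFReal_zero_one_le (x : ℝ) :
    gaussianPDFReal 0 1 x ≤ (2 / 5) * (1 - x ^ 2 / 2 + x ^ 4 / 4) := by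
  have hc : (√(2 * Real.pi * 1))⁻¹ ≤ 2 / 5 := by
    rw [inv_le_comm₀ (by positivity) (by norm_num)]
    apply Real.le_sqrt_of_sq_le
    nlinarith [Real.pi_gt_d2]
  have hy : 0 ≤ x ^ 2 / 2 := by positivity
  have he : Real.exp (-(x ^ 2 / 2)) ≤ 1 - x ^ 2 / 2 + x ^ 4 / 4 := by
    rw [Real.exp_neg]
    refine (inv_anti₀ (by positivity) (Real.add_one_le_exp (x ^ 2 / 2))).trans ?_
    rw [inv_le_iff_one_le_mul₀ (by positivity)]
    nlinarith [pow_nonneg hy 3]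
  rw [gaussianPDFReal]
  simp only [NNReal.coe_one, sub_zero, mul_one, neg_div]
  rw [mul_one] at hc
  exact mul_le_mul hc he (Real.exp_pos _).le (by norm_num)

lemma one_fifth_lt_stdNormalCDF : (1 / 5 : ℝ) < stdNormalCDF (-(Real.pi / 4)) := by
  have hsplit : stdNormalCDF (-(Real.pi / 4)) + (gaussianReal 0 1).real (Set.Ioc (-(Real.pi / 4)) 0)
      = 1 / 2 := by
    rw [← stdNormalCDF_zero, stdNormalCDF, stdNormalCDF, cdf_eq_real, cdf_eq_real,
      ← measureReal_union (Set.Iic_disjoint_Ioc le_rfl) measurableSet_Ioc,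
      Set.Iic_union_Ioc_eq_Iic (by linarith [Real.pi_pos])]
  have hint : (gaussianReal 0 1).real (Set.Ioc (-(Real.pi / 4)) 0) =
      ∫ x in (-(Real.pi / 4))..0, gaussianPDFReal 0 1 x := by
    rw [intervalIntegral.integral_of_le (by linarith [Real.pi_pos]), measureReal_def,
      gaussianReal_apply_eq_integral _ one_ne_zero, ENNReal.toReal_ofReal]
    exact integral_nonneg fun x => gaussianPDFReal_nonneg _ _ _
  have hle : ∫ x in (-(Real.pi / 4))..0, gaussianPDFReal 0 1 x ≤
      ∫ x in (-(Real.pi / 4))..0, (2 / 5 : ℝ) * (1 - x ^ 2 / 2 + x ^ 4 / 4) :=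
    intervalIntegral.integral_mono_on (by linarith [Real.pi_pos])
      (integrable_gaussianPDFReal _ _).intervalIntegrable
      (Continuous.intervalIntegrable (by fun_prop) _ _) fun x _ => gaussianPDFReal_zero_one_le x
  have hval : ∫ x in (-(Real.pi / 4))..0, (2 / 5 : ℝ) * (1 - x ^ 2 / 2 + x ^ 4 / 4) =
      2 / 5 * (Real.pi / 4 - (Real.pi / 4) ^ 3 / 6 + (Real.pi / 4) ^ 5 / 20) := by
    have hd : ∀ x ∈ Set.uIcc (-(Real.pi / 4)) 0, HasDerivAt
        (fun x : ℝ => (2 / 5 : ℝ) * (x - x ^ 3 / 6 + x ^ 5 / 20))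
        ((2 / 5 : ℝ) * (1 - x ^ 2 / 2 + x ^ 4 / 4)) x := fun x _ => by
      have := (((hasDerivAt_id x).sub ((hasDerivAt_pow 3 x).div_const 6)).add
        ((hasDerivAt_pow 5 x).div_const 20)).const_mul (2 / 5 : ℝ)
      refine this.congr_deriv ?_
      push_cast
      ring
    rw [intervalIntegral.integral_eq_sub_of_hasDerivAt hd
      (Continuous.intervalIntegrable (by fun_prop) _ _)]
    ring
  have hnum : 2 / 5 * (Real.pi / 4 - (Real.pi / 4) ^ 3 / 6 + (Real.pi / 4) ^ 5 / 20) < 3 / 10 := by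
    have h1 : Real.pi / 4 < 0.79 := by linarith [Real.pi_lt_d2]
    -- The cubic term is subtracted, so it needs a lower bound on `π / 4`.
    have h2 : 0.78 < Real.pi / 4 := by linarith [Real.pi_gt_d2]
    have h3 := pow_le_pow_left₀ (by norm_num) h2.le 3
    have h5 := pow_le_pow_left₀ (by linarith) h1.le 5
    norm_num at h1 h3 h5 ⊢
    linarith
  linarith

theorem mainTheorem2 :
    Tendsto (fun k : ℕ => majorityError k k) oddAtTop (𝓝 (1 / 2 : ℝ)) ∧
    (Tendsto (fun k : ℕ => majorityError k (k ^ 2)) oddAtTop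
        (𝓝 (stdNormalCDF (-(Real.pi / 4)))) ∧
      (1 / 5 : ℝ) < stdNormalCDF (-(Real.pi / 4))) ∧
    (∀ s : ℕ, 2 < s →
      Tendsto (fun k : ℕ => majorityError k (k ^ s)) oddAtTop (𝓝 (0 : ℝ))) ∧
    (∀ s : ℝ, 2 < s → ∀ g : ℕ → ℕ,
      (∀ k : ℕ, Odd k → |(g k : ℝ) - (k : ℝ) ^ s| ≤ 1) →
      Tendsto (fun k : ℕ => majorityError k (g k)) oddAtTop (𝓝 (0 : ℝ))) := by
  have hle : oddAtTop ≤ atTop := inf_le_left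
  refine ⟨?_, ⟨?_, one_fifth_lt_stdNormalCDF⟩, fun s hs => ?_,
    fun s hs g hg => tendsto_majorityError_rpow hs hg⟩
  · rw [← stdNormalCDF_zero, ← neg_zero]
    refine (tendsto_majorityError (n := fun k => k) tendsto_id ?_).mono_left hle
    have hinv : Tendsto (fun k : ℕ => (√(k : ℝ))⁻¹) atTop (𝓝 0) :=
      tendsto_inv_atTop_zero.comp (Real.tendsto_sqrt_atTop.comp tendsto_natCast_atTop_atTop)
    have h := hinv.mul tendsto_mul_two_mul_cosSqProb_sub_one
    rw [zero_mul] at h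
    refine h.congr fun k => ?_
    rw [← mul_assoc, inv_mul_eq_div, Real.div_sqrt]
  · refine (tendsto_majorityError (n := fun k => k ^ 2) (tendsto_pow_atTop two_ne_zero)
      ?_).mono_left hle
    refine tendsto_mul_two_mul_cosSqProb_sub_one.congr fun k => ?_
    rw [Nat.cast_pow, Real.sqrt_sq k.cast_nonneg]
  · refine tendsto_majorityError_rpow (s := s) (by exact_mod_cast hs) fun k _ => ?_
    simp
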